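/- Let $X$ be a metric space. For $n\ge 0$ let $C_n(X)$ be the group of integral singular $n$-chains of $X$, i.e. the free abelian group on the continuous maps $\Delta^n\to X$, let $C_n^L(X)\subset C_n(X)$ be the subgroup of singular Lipschitz chains, i.e. of those chains all of whose simplices are Lipschitz maps, let $b$ be the boundary operator (with $bc=0$ for $0$-chains; the condition $bc\in C^L_{-1}(X)=0$ below is thus empty for $n=0$), and let $sd^m$ be the $m$-fold iterated barycentric subdivision. For a chain $c=\sum_i n_i\sigma_i$ with distinct simplices $\sigma_i$ and all $n_i\neq 0$, write $\operatorname{im}(c)=\bigcup_i\sigma_i(\Delta^n)$, and for $A\subset X$ write $B_\epsilon(A)=\{y\in X:\ d(A,y)<\epsilon\}$ (so $B_\epsilon(\emptyset)=\emptyset$). A bounded subset $S\subset X$ *admits a strong $\gamma$-Lipschitz contraction*, $\gamma>0$, if there are a map $\phi:[0,1]\times S\to X$ and a point $x_0\in X$ with $\phi(1,s)=s$ and $\phi(0,s)=x_0$ for all $s\in S$ and $$d(\phi(t,s),\phi(t',s'))\le\gamma\operatorname{diam}(S)\,|t-t'|+\gamma\, d(s,s')\qquad (t,t'\in[0,1],\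 s,s'\in S).$$ The space $X$ *admits locally strong Lipschitz contractions* if for every $x\in X$ there are $r_x>0$ and $\gamma_x>0$ such that every subset $U$ of the open ball $B_{r_x}(x)$ admits a strong $\gamma_x$-Lipschitz contraction. **Theorem.** Let $X$ be a metric space. Then $C_0^L(X)=C_0(X)$. Suppose in addition that $X$ admits locally strong Lipschitz contractions, and let $\epsilon>0$ and $n\ge 0$. Then for every $c\in C_n(X)$ with $bc\in C_{n-1}^L(X)$ there exist $N\ge 1$, chains $c_1,\dots,c_N\in C_n(X)$, $c_1^L,\dots,c_N^L\in C_n^L(X)$ and $\bar c_1,\dots,\bar c_N\in C_{n+1}(X)$ such that 1. there is an integer $m\ge 0$ with $\sum_{i=1}^N c_i=sd^m(c)$, and $b\bar c_i=c_i-c_i^L$ for all $i$; 2. $\operatorname{im}(\bar c_i)\subset B_\epsilon(\operatorname{im}(c))$ and $\operatorname{diam}(\operatorname{im}(\bar c_i))<\epsilon$ for all $i$. -/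

import Mathlib

namespace SingLip

noncomputable section

/-- The standard `n`-simplex `Δⁿ ⊆ ℝⁿ⁺¹`. It carries the metric that Mathlib puts on `Fin (n+1) → ℝ`
(the maximum metric), which is bi-Lipschitz equivalent to the Euclidean one; hence it gives the same
topology and the same Lipschitz maps. -/
abbrev Simplex (n : ℕ) : Type := stdSimplex ℝ (Fin (n + 1))

/-- The inclusion `Δⁿ → Δⁿ⁺¹` of the face opposite to the `j`-th vertex. -/
def face {n : ℕ} (j : Fin (n + 2)) : C(Simplex n, Simplex (n + 1)) :=
  ⟨stdSimplex.map j.succAbove, stdSimplex.continuous_map _⟩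

/-- Integral singular `n`-chains of `X`: the free abelian group on the continuous maps `Δⁿ → X`. -/
abbrev Chain (X : Type*) [TopologicalSpace X] (n : ℕ) : Type _ := C(Simplex n, X) →₀ ℤ

/-- The boundary of singular chains, `b σ = ∑ⱼ (-1)ʲ σ|[e₀, …, êⱼ, …, eₙ₊₁]`. -/
def boundary {X : Type*} [TopologicalSpace X] {n : ℕ} : Chain X (n + 1) →ₗ[ℤ] Chain X n :=
  Finsupp.linearCombination ℤ fun σ : C(Simplex (n + 1), X) =>
    ∑ j : Fin (n + 2), Finsupp.single (σ.comp (face j)) ((-1) ^ (j : ℕ))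

/-- The push-forward `f_# c` of a singular chain by a continuous map `f`. -/
def pushforward {X Y : Type*} [TopologicalSpace X] [TopologicalSpace Y] (f : C(X, Y)) {n : ℕ} :
    Chain X n →ₗ[ℤ] Chain Y n :=
  Finsupp.lmapDomain ℤ ℤ fun σ : C(Simplex n, X) => f.comp σ

/-- `im c`: the union of the images of the simplices that occur in `c` with nonzero coefficient. -/
def image {X : Type*} [TopologicalSpace X] {n : ℕ} (c : Chain X n) : Set X :=
  ⋃ σ ∈ c.support, Set.range σ

/-- The group `C_n^L(X)` of singular Lipschitz `n`-chains: the chains all of whose simplices are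
Lipschitz maps. -/
def lipschitzChains (X : Type*) [MetricSpace X] (n : ℕ) : Submodule ℤ (Chain X n) :=
  Finsupp.supported ℤ ℤ {σ : C(Simplex n, X) | ∃ K : NNReal, LipschitzWith K σ}

/-- The boundary of `c` is a Lipschitz chain. This is no condition on a `0`-chain, whose boundary
is zero. -/
def HasLipschitzBoundary {X : Type*} [MetricSpace X] : {n : ℕ} → Chain X n → Prop
  | 0, _ => True
  | n + 1, c => boundary c ∈ lipschitzChains X n

/-! ### Barycentric subdivision

As usual, it is first defined for affine simplices in a standard simplex, by coning off the
subdivided boundary from the barycenter, and then carried over to all singular simplices by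
naturality. An affine simplex `[v₀, …, vₙ]` is given by the tuple of its vertices. -/

/-- The affine map `Δⁿ → Δᵏ` that sends the `i`-th vertex to `v i`. -/
def affineSimplex {k n : ℕ} (v : Fin (n + 1) → Simplex k) : C(Simplex n, Simplex k) where
  toFun s := ⟨∑ i, s i • (v i : Fin (k + 1) → ℝ),
    (convex_stdSimplex ℝ (Fin (k + 1))).sum_mem (fun i _ => s.2.1 i) s.2.2 fun i _ => (v i).2⟩
  continuous_toFun := by
    refine Continuous.subtype_mk (continuous_finsetSum _ fun i _ => ?_) _
    exact ((continuous_apply i).comp continuous_subtype_val).smul continuous_const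

/-- The free abelian group on the affine `n`-simplices `[v₀, …, vₙ]` in `Δᵏ`. -/
abbrev AffineChain (k n : ℕ) : Type := (Fin (n + 1) → Simplex k) →₀ ℤ

/-- `[v₀, …, vₙ₊₁] ↦ ∑ⱼ (-1)ʲ [v₀, …, v̂ⱼ, …, vₙ₊₁]`. -/
def affineBoundary {k n : ℕ} : AffineChain k (n + 1) →ₗ[ℤ] AffineChain k n :=
  Finsupp.linearCombination ℤ fun v : Fin (n + 2) → Simplex k =>
    ∑ j : Fin (n + 2), Finsupp.single (v ∘ j.succAbove) ((-1) ^ (j : ℕ))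

/-- The cone with apex `p`: `[v₀, …, vₙ] ↦ [p, v₀, …, vₙ]`. -/
def cone {k n : ℕ} (p : Simplex k) : AffineChain k n →ₗ[ℤ] AffineChain k (n + 1) :=
  Finsupp.lmapDomain ℤ ℤ fun v : Fin (n + 1) → Simplex k => (Fin.cons p v : Fin (n + 2) → Simplex k)

/-- Barycentric subdivision of affine chains: the identity in dimension `0`, and
`sd v = cone (barycenter of v) (sd (b v))` for affine simplices `v` of positive dimension. -/
def affineSubdivision {k : ℕ} : (n : ℕ) → AffineChain k n →ₗ[ℤ] AffineChain k n
  | 0 => LinearMap.id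
  | n + 1 => Finsupp.linearCombination ℤ fun v : Fin (n + 2) → Simplex k =>
      cone (affineSimplex v stdSimplex.barycenter)
        (affineSubdivision n (affineBoundary (Finsupp.single v 1)))

/-- An affine chain in `Δᵏ`, regarded as a singular chain of `Δᵏ`. -/
def affineToSingular {k n : ℕ} : AffineChain k n →ₗ[ℤ] Chain (Simplex k) n :=
  Finsupp.lmapDomain ℤ ℤ affineSimplex

/-- Barycentric subdivision of singular chains: `sd σ = σ_# (sd [e₀, …, eₙ])`. -/
def subdivision {X : Type*} [TopologicalSpace X] {n : ℕ} : Chain X n →ₗ[ℤ] Chain X n :=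
  Finsupp.linearCombination ℤ fun σ : C(Simplex n, X) =>
    pushforward σ (affineToSingular (affineSubdivision n
      (Finsupp.single (fun i => stdSimplex.vertex i) 1)))

/-- `S` admits a strong `γ`-Lipschitz contraction in `X`. Here `S` is meant to be bounded, so that
`Metric.diam S` is its actual diameter. -/
def AdmitsStrongLipschitzContraction {X : Type*} [MetricSpace X] (γ : ℝ) (S : Set X) : Prop :=
  ∃ (φ : unitInterval → S → X) (x₀ : X),
    (∀ s, φ 1 s = s) ∧ (∀ s, φ 0 s = x₀) ∧
    ∀ t t' s s', dist (φ t s) (φ t' s') ≤ γ * Metric.diam S * dist t t' + γ * dist s s'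

/-- `X` admits locally strong Lipschitz contractions. -/
def AdmitsLocallyStrongLipschitzContractions (X : Type*) [MetricSpace X] : Prop :=
  ∀ x : X, ∃ r : ℝ, 0 < r ∧ ∃ γ : ℝ, 0 < γ ∧
    ∀ U : Set X, U ⊆ Metric.ball x r → AdmitsStrongLipschitzContraction γ U

end

end SingLip

namespace SingLip

noncomputable section

/-! After enough barycentric subdivision every simplex of `c` has diameter at most a small `δ`
(`exists_subdivision_iterate_mem_supported`), and a small simplex lies in a ball that contracts in a
Lipschitz way. Coning along such a contraction fills a reduced cycle of that ball inside a ball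
larger by the factor `1 + 2γ`, and the filling is Lipschitz when the cycle is (`exists_filling`).

Such fillings give, by induction on the dimension, operators `L` (Lipschitz approximation) and `H`
(homotopy) with `bH = id - L - Hb` on small chains. For a simplex `τ` take `L τ` to be a Lipschitz
filling of `L (b τ)`, and `H τ` a filling of the cycle `τ - L τ - H (b τ)`. On Lipschitz simplices
one takes `L τ = τ` and `H τ = 0` instead. Hence `H (b z) = 0` when `b z` is Lipschitz, and then `bH
z = z - L z` (`LipschitzApproximation.nonempty_succ`).

Compactness of `im c` makes `r` and `γ` uniform, so in a fixed dimension `H` moves simplices by at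
most `A δ`, with `A` independent of `δ`.

If the subdivided chain is `∑ nᵢ τᵢ`, the pieces are `c̄ᵢ = nᵢ H τᵢ`, `cᵢᴸ = nᵢ L τᵢ` and `cᵢ = nᵢ
(bH τᵢ + L τᵢ)`. In general `cᵢ` is not `nᵢ τᵢ`: it differs from it by `nᵢ H (b τᵢ)`, and these
corrections cancel in the sum because the total boundary is Lipschitz. -/

variable {X Y : Type*} [TopologicalSpace X] [TopologicalSpace Y]

/-! ### The singular chain complex -/

/-- The cancellation behind `∂ ∘ ∂ = 0`: a double alternating sum vanishes if its terms depend only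
on the pair of omitted vertices. -/
lemma alternating_double_sum_eq_zero {M : Type*} [AddCommGroup M] {n : ℕ}
    (F : Fin (n + 2) → Fin (n + 1) → M)
    (hF : ∀ i j, F (i.succAbove j) (j.predAbove i) = F i j) :
    ∑ i : Fin (n + 2), ∑ j : Fin (n + 1), ((-1 : ℤ) ^ (i : ℕ) * (-1) ^ (j : ℕ)) • F i j = 0 := by
  rw [← Finset.sum_product', Finset.univ_product_univ]
  -- The involution exchanges the order in which the same two vertices are omitted. It reverses the
  -- sign and has no fixed point.
  refine Finset.sum_involution
    (fun p _ => (p.1.succAbove p.2, p.2.predAbove p.1)) ?_ ?_ (fun _ _ => Finset.mem_univ _) ?_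
  · rintro ⟨i, j⟩ -
    simp only [hF, ← pow_add, Fin.neg_one_pow_succAbove_add_predAbove, neg_smul, add_neg_cancel]
  · rintro ⟨i, j⟩ - - h
    exact Fin.succAbove_ne i j (congrArg Prod.fst h)
  · rintro ⟨i, j⟩ -
    simp only [Fin.succAbove_succAbove_predAbove, Fin.predAbove_predAbove_succAbove]

lemma boundary_single {n : ℕ} (σ : C(Simplex (n + 1), X)) (a : ℤ) :
    boundary (Finsupp.single σ a) =
      a • ∑ j : Fin (n + 2), Finsupp.single (σ.comp (face j)) ((-1 : ℤ) ^ (j : ℕ)) := by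
  simp only [boundary, Finsupp.linearCombination_single]

@[simp]
lemma pushforward_single (f : C(X, Y)) {n : ℕ} (σ : C(Simplex n, X)) (a : ℤ) :
    pushforward f (Finsupp.single σ a) = Finsupp.single (f.comp σ) a := by
  simp [pushforward]

lemma pushforward_comp {Z : Type*} [TopologicalSpace Z] (g : C(Y, Z)) (f : C(X, Y)) {n : ℕ}
    (c : Chain X n) : pushforward (g.comp f) c = pushforward g (pushforward f c) := by
  induction c using Finsupp.induction_linear with
  | zero => simp
  | add c d hc hd => simp [hc, hd]
  | single σ a => simp [ContinuousMap.comp_assoc]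

lemma boundary_pushforward (f : C(X, Y)) {n : ℕ} (c : Chain X (n + 1)) :
    boundary (pushforward f c) = pushforward f (boundary c) := by
  induction c using Finsupp.induction_linear with
  | zero => simp
  | add c d hc hd => simp only [map_add, hc, hd]
  | single σ a =>
    simp only [pushforward_single, boundary_single, map_smul, map_sum, ContinuousMap.comp_assoc]

lemma face_comp_face {n : ℕ} (i : Fin (n + 3)) (j : Fin (n + 2)) :
    (face (i.succAbove j)).comp (face (j.predAbove i)) = (face i).comp (face j) := by
  ext1 x
  simp only [face, ContinuousMap.comp_apply, ContinuousMap.coe_mk, stdSimplex.map_comp_apply]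
  congr 1
  funext k
  exact Fin.succAbove_succAbove_succAbove_predAbove i j k

lemma boundary_boundary {n : ℕ} (c : Chain X (n + 2)) : boundary (boundary c) = 0 := by
  induction c using Finsupp.induction_linear with
  | zero => simp
  | add c d hc hd => simp only [map_add, hc, hd, add_zero]
  | single σ a =>
    rw [boundary_single, map_smul, map_sum]
    convert smul_zero a
    convert alternating_double_sum_eq_zero
      (fun i j => Finsupp.single ((σ.comp (face i)).comp (face j)) (1 : ℤ)) ?_ using 2 with i
    · rw [boundary_single, Finset.smul_sum]
      refine Finset.sum_congr rfl fun j _ => ?_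
      simp
    · intro i j
      simp only [ContinuousMap.comp_assoc, face_comp_face]

lemma face_apply_succAbove {n : ℕ} (j : Fin (n + 2)) (x : Simplex n) (i : Fin (n + 1)) :
    face j x (j.succAbove i) = x i := by
  change FunOnFinite.linearMap ℝ ℝ j.succAbove x (j.succAbove i) = x i
  rw [FunOnFinite.linearMap_apply_apply]
  simp [Finset.filter_eq']

lemma face_apply_self {n : ℕ} (j : Fin (n + 2)) (x : Simplex n) : face j x j = 0 := by
  change FunOnFinite.linearMap ℝ ℝ j.succAbove x j = 0
  rw [FunOnFinite.linearMap_apply_apply]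
  simp [Fin.succAbove_ne]

/-! ### Affine simplices -/

lemma affineSimplex_apply {k n : ℕ} (v : Fin (n + 1) → Simplex k) (s : Simplex n)
    (a : Fin (k + 1)) : affineSimplex v s a = ∑ i, s i * v i a := by
  change (∑ i, s i • (v i : Fin (k + 1) → ℝ)) a = _
  simp only [Finset.sum_apply, Pi.smul_apply, smul_eq_mul]

lemma affineSimplex_comp_face {k n : ℕ} (v : Fin (n + 2) → Simplex k) (j : Fin (n + 2)) :
    (affineSimplex v).comp (face j) = affineSimplex (v ∘ j.succAbove) := by
  ext s a
  change affineSimplex v (face j s) a = affineSimplex (v ∘ j.succAbove) s a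
  rw [affineSimplex_apply, affineSimplex_apply, Fin.sum_univ_succAbove _ j]
  simp [face_apply_self, face_apply_succAbove]

lemma affineSimplex_affineSimplex {k m n : ℕ} (v : Fin (m + 1) → Simplex k)
    (w : Fin (n + 1) → Simplex m) (s : Simplex n) :
    affineSimplex v (affineSimplex w s) = affineSimplex (fun i => affineSimplex v (w i)) s := by
  ext a
  change affineSimplex v (affineSimplex w s) a = affineSimplex (fun i => affineSimplex v (w i)) s a
  simp only [affineSimplex_apply, Finset.sum_mul, Finset.mul_sum]
  rw [Finset.sum_comm]
  simp only [mul_assoc]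

lemma affineSimplex_vertices (n : ℕ) :
    affineSimplex (fun i : Fin (n + 1) => stdSimplex.vertex i) = ContinuousMap.id _ := by
  ext s a
  change affineSimplex _ s a = s a
  rw [affineSimplex_apply]
  simp [Pi.single_apply]

lemma affineSimplex_vertex {k n : ℕ} (v : Fin (n + 1) → Simplex k) (i : Fin (n + 1)) :
    affineSimplex v (stdSimplex.vertex i) = v i := by
  ext a
  change affineSimplex v (stdSimplex.vertex i) a = v i a
  rw [affineSimplex_apply]
  simp [Pi.single_apply]

/-! ### Affine chains and barycentric subdivision -/

lemma affineBoundary_single {k n : ℕ} (v : Fin (n + 2) → Simplex k) (a : ℤ) :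
    affineBoundary (Finsupp.single v a) =
      a • ∑ j : Fin (n + 2), Finsupp.single (v ∘ j.succAbove) ((-1 : ℤ) ^ (j : ℕ)) := by
  simp only [affineBoundary, Finsupp.linearCombination_single]

lemma affineBoundary_affineBoundary {k n : ℕ} (c : AffineChain k (n + 2)) :
    affineBoundary (affineBoundary c) = 0 := by
  induction c using Finsupp.induction_linear with
  | zero => simp
  | add c d hc hd => simp only [map_add, hc, hd, add_zero]
  | single v a =>
    rw [affineBoundary_single, map_smul, map_sum]
    convert smul_zero a
    convert alternating_double_sum_eq_zero
      (fun i j => Finsupp.single ((v ∘ i.succAbove) ∘ j.succAbove) (1 : ℤ)) ?_ using 2 with i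
    · rw [affineBoundary_single, Finset.smul_sum]
      refine Finset.sum_congr rfl fun j _ => ?_
      simp
    · intro i j
      congr 1
      funext k
      exact congrArg v (Fin.succAbove_succAbove_succAbove_predAbove i j k)

@[simp]
lemma cone_single {k n : ℕ} (p : Simplex k) (v : Fin (n + 1) → Simplex k) (a : ℤ) :
    cone p (Finsupp.single v a) = Finsupp.single (Fin.cons p v : Fin (n + 2) → Simplex k) a := by
  simp [cone]

/-- The face opposite the apex is the base. The other faces are cones over the faces of the base,
with index shifted by one, hence the minus sign. -/
lemma affineBoundary_cone_succ {k n : ℕ} (p : Simplex k) (c : AffineChain k (n + 1)) :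
    affineBoundary (cone p c) = c - cone p (affineBoundary c) := by
  induction c using Finsupp.induction_linear with
  | zero => simp
  | add c d hc hd => simp only [map_add, hc, hd]; abel
  | single v a =>
    rw [cone_single, affineBoundary_single, affineBoundary_single, Fin.sum_univ_succ, map_smul,
      map_sum, smul_add, sub_eq_add_neg]
    congr 1
    · simp only [Fin.val_zero, pow_zero, Finsupp.smul_single, smul_eq_mul, mul_one]
      congr 1
    · rw [← smul_neg, ← Finset.sum_neg_distrib]
      congr 1
      refine Finset.sum_congr rfl fun j _ => ?_
      rw [cone_single, ← Finsupp.single_neg, Fin.val_succ, pow_succ, mul_neg_one]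
      congr 1
      funext i
      refine Fin.cases ?_ (fun i => ?_) i
      · simp
      · simp [Fin.succ_succAbove_succ]

/-- The sum of the coefficients of a finitely supported function. -/
def degree {ι : Type*} : (ι →₀ ℤ) →ₗ[ℤ] ℤ := Finsupp.linearCombination ℤ fun _ => (1 : ℤ)

@[simp]
lemma degree_single {ι : Type*} (i : ι) (a : ℤ) : degree (Finsupp.single i a) = a := by
  simp [degree]

/-- Over a point the remaining face is the apex itself, so the augmentation takes the place of the
boundary of the base. -/
lemma affineBoundary_cone_zero {k : ℕ} (p : Simplex k) (c : AffineChain k 0) :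
    affineBoundary (cone p c) = c - Finsupp.single (fun _ => p) (degree c) := by
  induction c using Finsupp.induction_linear with
  | zero => simp
  | add c d hc hd => simp only [map_add, hc, hd, Finsupp.single_add]; abel
  | single v a =>
    rw [cone_single, affineBoundary_single, Fin.sum_univ_two, degree_single, smul_add,
      sub_eq_add_neg]
    congr 1
    · simp only [Fin.val_zero, pow_zero, Finsupp.smul_single, smul_eq_mul, mul_one]
      congr 1
    · rw [Finsupp.smul_single, ← Finsupp.single_neg]
      congr 1
      · funext i
        fin_cases i
        rfl
      · simp

lemma degree_affineBoundary {k : ℕ} (c : AffineChain k 1) : degree (affineBoundary c) = 0 := by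
  induction c using Finsupp.induction_linear with
  | zero => simp
  | add c d hc hd => simp only [map_add, hc, hd, add_zero]
  | single v a => simp [affineBoundary_single]

lemma degree_boundary (c : Chain X 1) : degree (boundary c) = 0 := by
  induction c using Finsupp.induction_linear with
  | zero => simp
  | add c d hc hd => simp only [map_add, hc, hd, add_zero]
  | single v a => simp [boundary_single]

lemma affineSubdivision_succ_single {k n : ℕ} (v : Fin (n + 2) → Simplex k) (a : ℤ) :
    affineSubdivision (n + 1) (Finsupp.single v a) =
      a • cone (affineSimplex v stdSimplex.barycenter)
        (affineSubdivision n (affineBoundary (Finsupp.single v 1))) := by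
  simp only [affineSubdivision, Finsupp.linearCombination_single]

/-- By the cone formula the error is a cone over the boundary of the subdivided boundary, which
vanishes by induction and `b ∘ b = 0`; in the lowest dimension it vanishes because a boundary has
degree `0`. -/
lemma affineBoundary_affineSubdivision {k : ℕ} (n : ℕ) (c : AffineChain k (n + 1)) :
    affineBoundary (affineSubdivision (n + 1) c) = affineSubdivision n (affineBoundary c) := by
  induction n with
  | zero =>
    induction c using Finsupp.induction_linear with
    | zero => simp
    | add c d hc hd => simp only [map_add, hc, hd]
    | single v a =>
      rw [affineSubdivision_succ_single, map_smul, affineBoundary_cone_zero]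
      simp only [affineSubdivision, LinearMap.id_apply, degree_affineBoundary, Finsupp.single_zero,
        sub_zero]
      rw [← map_smul, Finsupp.smul_single, smul_eq_mul, mul_one]
  | succ n ih =>
    induction c using Finsupp.induction_linear with
    | zero => simp
    | add c d hc hd => simp only [map_add, hc, hd]
    | single v a =>
      rw [affineSubdivision_succ_single, map_smul, affineBoundary_cone_succ, ih,
        affineBoundary_affineBoundary, map_zero, map_zero, sub_zero, ← map_smul, ← map_smul,
        Finsupp.smul_single, smul_eq_mul, mul_one]

/-- The push-forward of affine chains by an affine map `Δᵐ → Δᵏ`, given by its vertices. -/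
def affinePushforward {k m : ℕ} (v : Fin (m + 1) → Simplex k) {n : ℕ} :
    AffineChain m n →ₗ[ℤ] AffineChain k n :=
  Finsupp.lmapDomain ℤ ℤ fun w i => affineSimplex v (w i)

@[simp]
lemma affinePushforward_single {k m n : ℕ} (v : Fin (m + 1) → Simplex k)
    (w : Fin (n + 1) → Simplex m) (a : ℤ) :
    affinePushforward v (Finsupp.single w a) =
      Finsupp.single (fun i => affineSimplex v (w i)) a := by
  simp [affinePushforward]

lemma affineBoundary_affinePushforward {k m n : ℕ} (v : Fin (m + 1) → Simplex k)
    (c : AffineChain m (n + 1)) :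
    affineBoundary (affinePushforward v c) = affinePushforward v (affineBoundary c) := by
  induction c using Finsupp.induction_linear with
  | zero => simp
  | add c d hc hd => simp only [map_add, hc, hd]
  | single w a =>
    simp only [affinePushforward_single, affineBoundary_single, map_smul, map_sum]
    rfl

lemma affinePushforward_cone {k m n : ℕ} (v : Fin (m + 1) → Simplex k) (p : Simplex m)
    (c : AffineChain m n) :
    affinePushforward v (cone p c) = cone (affineSimplex v p) (affinePushforward v c) := by
  induction c using Finsupp.induction_linear with
  | zero => simp
  | add c d hc hd => simp only [map_add, hc, hd]
  | single w a =>
    simp only [affinePushforward_single, cone_single]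
    congr 1
    funext i
    refine Fin.cases ?_ (fun i => ?_) i <;> simp

/-- Affine maps carry barycenters to barycenters and cones to cones. -/
lemma affineSubdivision_affinePushforward {k m : ℕ} (v : Fin (m + 1) → Simplex k) (n : ℕ)
    (c : AffineChain m n) :
    affineSubdivision n (affinePushforward v c) = affinePushforward v (affineSubdivision n c) := by
  induction n with
  | zero => rfl
  | succ n ih =>
    induction c using Finsupp.induction_linear with
    | zero => simp
    | add c d hc hd => simp only [map_add, hc, hd]
    | single w a =>
      rw [affinePushforward_single, affineSubdivision_succ_single, affineSubdivision_succ_single,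
        map_smul, affinePushforward_cone, ← ih, ← affineBoundary_affinePushforward,
        affinePushforward_single, affineSimplex_affineSimplex]

@[simp]
lemma affineToSingular_single {k n : ℕ} (v : Fin (n + 1) → Simplex k) (a : ℤ) :
    affineToSingular (Finsupp.single v a) = Finsupp.single (affineSimplex v) a := by
  simp [affineToSingular]

lemma boundary_affineToSingular {k n : ℕ} (c : AffineChain k (n + 1)) :
    boundary (affineToSingular c) = affineToSingular (affineBoundary c) := by
  induction c using Finsupp.induction_linear with
  | zero => simp
  | add c d hc hd => simp only [map_add, hc, hd]
  | single w a =>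
    simp only [affineToSingular_single, boundary_single, affineBoundary_single, map_smul, map_sum,
      affineSimplex_comp_face]

lemma affineToSingular_affinePushforward {k m n : ℕ} (v : Fin (m + 1) → Simplex k)
    (c : AffineChain m n) :
    affineToSingular (affinePushforward v c) =
      pushforward (affineSimplex v) (affineToSingular c) := by
  induction c using Finsupp.induction_linear with
  | zero => simp
  | add c d hc hd => simp only [map_add, hc, hd]
  | single w a =>
    simp only [affineToSingular_single, affinePushforward_single, pushforward_single]
    congr 1
    ext1 s
    exact (affineSimplex_affineSimplex v w s).symm

lemma subdivision_single {n : ℕ} (σ : C(Simplex n, X)) (a : ℤ) :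
    subdivision (Finsupp.single σ a) = a • pushforward σ (affineToSingular (affineSubdivision n
      (Finsupp.single (fun i => stdSimplex.vertex i) 1))) := by
  simp only [subdivision, Finsupp.linearCombination_single]

lemma subdivision_pushforward (f : C(X, Y)) {n : ℕ} (c : Chain X n) :
    subdivision (pushforward f c) = pushforward f (subdivision c) := by
  induction c using Finsupp.induction_linear with
  | zero => simp
  | add c d hc hd => simp only [map_add, hc, hd]
  | single σ a => simp only [pushforward_single, subdivision_single, map_smul, pushforward_comp]

lemma subdivision_affineToSingular {k n : ℕ} (c : AffineChain k n) :
    subdivision (affineToSingular c) = affineToSingular (affineSubdivision n c) := by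
  induction c using Finsupp.induction_linear with
  | zero => simp
  | add c d hc hd => simp only [map_add, hc, hd]
  | single v a =>
    rw [affineToSingular_single, subdivision_single, ← affineToSingular_affinePushforward,
      ← affineSubdivision_affinePushforward, affinePushforward_single]
    simp only [affineSimplex_vertex]
    rw [← map_smul, ← map_smul, Finsupp.smul_single, smul_eq_mul, mul_one]

/-- Naturality reduces this to the simplex `[e₀, …, eₙ₊₁]`, where the affine statement applies. -/
lemma boundary_subdivision {n : ℕ} (c : Chain X (n + 1)) :
    boundary (subdivision c) = subdivision (boundary c) := by
  induction c using Finsupp.induction_linear with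
  | zero => simp
  | add c d hc hd => simp only [map_add, hc, hd]
  | single σ a =>
    rw [subdivision_single, map_smul, boundary_pushforward, boundary_affineToSingular,
      affineBoundary_affineSubdivision, ← subdivision_affineToSingular, ← subdivision_pushforward,
      ← boundary_affineToSingular, ← boundary_pushforward, affineToSingular_single,
      pushforward_single, affineSimplex_vertices, ContinuousMap.comp_id, ← map_smul, ← map_smul,
      Finsupp.smul_single, smul_eq_mul, mul_one]

end

end SingLip

namespace SingLip

noncomputable section

variable {X : Type*}

/-! ### Supports of chains -/

/-- Membership of the image of a chain in a subgroup need only be checked on the simplices allowed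
in the chain. Most support, size and Lipschitz estimates below use this. -/
lemma map_mem_of_mem_supported {ι M : Type*} [AddCommGroup M] (f : (ι →₀ ℤ) →ₗ[ℤ] M)
    (p : Submodule ℤ M) {s : Set ι} (h : ∀ i ∈ s, f (Finsupp.single i 1) ∈ p) {c : ι →₀ ℤ}
    (hc : c ∈ Finsupp.supported ℤ ℤ s) : f c ∈ p := by
  rw [Finsupp.supported_eq_span_single] at hc
  refine (Submodule.span_le (p := p.comap f)).2 ?_ hc
  rintro _ ⟨i, hi, rfl⟩
  exact h i hi

lemma single_mem_supported_iff {ι : Type*} {s : Set ι} {i : ι} :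
    Finsupp.single i (1 : ℤ) ∈ Finsupp.supported ℤ ℤ s ↔ i ∈ s := by
  rw [Finsupp.mem_supported, Finsupp.support_single _ one_ne_zero]
  simp

/-- The singular chains of `X` all of whose simplices lie in `A`. -/
def chainsIn [TopologicalSpace X] (A : Set X) (n : ℕ) : Submodule ℤ (Chain X n) :=
  Finsupp.supported ℤ ℤ {σ : C(Simplex n, X) | Set.range σ ⊆ A}

lemma mem_chainsIn_iff [TopologicalSpace X] {n : ℕ} {c : Chain X n} {A : Set X} :
    c ∈ chainsIn A n ↔ image c ⊆ A := by
  simp only [chainsIn, Finsupp.mem_supported, image, Set.iUnion_subset_iff]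
  rfl

lemma boundary_mem_supported [TopologicalSpace X] {n : ℕ} {s : Set C(Simplex (n + 1), X)}
    {t : Set C(Simplex n, X)} (h : ∀ σ ∈ s, ∀ j, σ.comp (face j) ∈ t) {c : Chain X (n + 1)}
    (hc : c ∈ Finsupp.supported ℤ ℤ s) : boundary c ∈ Finsupp.supported ℤ ℤ t := by
  refine map_mem_of_mem_supported boundary _ (fun σ hσ => ?_) hc
  rw [boundary_single]
  exact Submodule.smul_mem _ _ (Submodule.sum_mem _ fun j _ =>
    Finsupp.single_mem_supported ℤ _ (h σ hσ j))

/-! ### Affine simplices shrink under subdivision -/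

lemma dist_affineSimplex_le {k n : ℕ} {v : Fin (n + 1) → Simplex k} {p : Simplex k} {D : ℝ}
    (h : ∀ i, dist (v i) p ≤ D) (s : Simplex n) : dist (affineSimplex v s) p ≤ D := by
  have := (convex_closedBall (p : Fin (k + 1) → ℝ) D).sum_mem (t := Finset.univ)
    (w := fun i => s i) (z := fun i => (v i : Fin (k + 1) → ℝ)) (fun i _ => s.2.1 i) s.2.2
    fun i _ => h i
  exact this

lemma dist_affineSimplex_barycenter_le {k n : ℕ} {v : Fin (n + 2) → Simplex k} {D : ℝ}
    (h : ∀ i j, dist (v i) (v j) ≤ D) (i : Fin (n + 2)) :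
    dist (affineSimplex v stdSimplex.barycenter) (v i) ≤ ((n + 1 : ℕ) / ((n + 1 : ℕ) + 1)) * D := by
  have hD : 0 ≤ D := dist_nonneg.trans (h 0 0)
  have hn : (0 : ℝ) < (n : ℝ) + 1 + 1 := by positivity
  refine (dist_pi_le_iff (by positivity)).2 fun a => ?_
  -- Of the `n + 2` differences averaged by the barycenter, the one at `i` is zero; this gives the
  -- factor `(n + 1) / (n + 2)`.
  have e : affineSimplex v stdSimplex.barycenter a - v i a =
      ((n : ℝ) + 1 + 1)⁻¹ * ∑ j : Fin (n + 1), (v (i.succAbove j) a - v i a) := by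
    have hb : ∀ j, (stdSimplex.barycenter : Simplex (n + 1)) j = ((n : ℝ) + 1 + 1)⁻¹ := by
      intro j
      refine (stdSimplex.barycenter_apply j).trans ?_
      simp [add_assoc, one_add_one_eq_two]
    rw [affineSimplex_apply, Fin.sum_univ_succAbove _ i]
    simp only [hb, ← Finset.mul_sum, Finset.sum_sub_distrib, Finset.sum_const, Finset.card_univ,
      Fintype.card_fin, nsmul_eq_mul]
    push_cast
    field_simp
    ring
  have hd : ∀ j, |v j a - v i a| ≤ D := fun j =>
    (dist_le_pi_dist (v j : Fin (k + 1) → ℝ) (v i) a).trans (h j i)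
  change |affineSimplex v stdSimplex.barycenter a - v i a| ≤ _
  rw [e, abs_mul, abs_of_pos (inv_pos.2 hn)]
  calc ((n : ℝ) + 1 + 1)⁻¹ * |∑ j : Fin (n + 1), (v (i.succAbove j) a - v i a)|
      ≤ ((n : ℝ) + 1 + 1)⁻¹ * ∑ _j : Fin (n + 1), D := by
        gcongr
        exact (Finset.abs_sum_le_sum_abs _ _).trans (Finset.sum_le_sum fun j _ => hd _)
    _ = _ := by
        simp only [Finset.sum_const, Finset.card_univ, Fintype.card_fin, nsmul_eq_mul]
        push_cast
        ring

/-- The condition on the range is carried along for the induction: it keeps the vertices of the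
subdivided faces inside `v`, where their distance to the barycenter is controlled. -/
lemma affineSubdivision_single_mem_supported {k : ℕ} (n : ℕ) {v : Fin (n + 1) → Simplex k} {D : ℝ}
    (h : ∀ i j, dist (v i) (v j) ≤ D) :
    affineSubdivision n (Finsupp.single v 1) ∈ Finsupp.supported ℤ ℤ
      {w : Fin (n + 1) → Simplex k | (∀ i j, dist (w i) (w j) ≤ (n / (n + 1) : ℝ) * D) ∧
        ∀ i, w i ∈ Set.range (affineSimplex v)} := by
  induction n with
  | zero =>
    refine single_mem_supported_iff.2 ⟨fun i j => ?_, fun i => ⟨_, affineSimplex_vertex v i⟩⟩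
    simp [Fin.fin_one_eq_zero]
  | succ n ih =>
    have hD : 0 ≤ D := dist_nonneg.trans (h 0 0)
    have hn : (n / (n + 1) : ℝ) * D ≤ ((n + 1 : ℕ) / ((n + 1 : ℕ) + 1)) * D := by
      refine mul_le_mul_of_nonneg_right ?_ hD
      rw [div_le_div_iff₀ (by positivity) (by positivity)]
      push_cast
      nlinarith
    have hb := dist_affineSimplex_barycenter_le h
    have hb' : ∀ s, dist (affineSimplex v s) (affineSimplex v stdSimplex.barycenter) ≤
        ((n + 1 : ℕ) / ((n + 1 : ℕ) + 1)) * D :=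
      dist_affineSimplex_le fun i => (dist_comm _ _).trans_le (hb i)
    rw [affineSubdivision_succ_single, one_smul, affineBoundary_single, one_smul, map_sum, map_sum]
    refine Submodule.sum_mem _ fun j _ => ?_
    rw [← Finsupp.smul_single_one, map_smul, map_smul]
    refine Submodule.smul_mem _ _ (map_mem_of_mem_supported _ _ ?_
      (ih fun a b => h (j.succAbove a) (j.succAbove b)))
    rintro w ⟨hw, hwv⟩
    rw [cone_single]
    have hw' : ∀ i, w i ∈ Set.range (affineSimplex v) := fun i => by
      obtain ⟨s, hs⟩ := hwv i
      exact ⟨face j s, by rw [← hs, ← affineSimplex_comp_face]; rfl⟩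
    have hwb : ∀ i, dist (w i) (affineSimplex v stdSimplex.barycenter) ≤
        ((n + 1 : ℕ) / ((n + 1 : ℕ) + 1)) * D := fun i => by
      obtain ⟨s, hs⟩ := hw' i
      exact hs ▸ hb' s
    refine single_mem_supported_iff.2 ⟨fun a b => ?_, fun a => ?_⟩
    · refine Fin.cases ?_ (fun a => ?_) a <;> refine Fin.cases ?_ (fun b => ?_) b
      · simp only [Fin.cons_zero, dist_self]
        positivity
      · simp only [Fin.cons_zero, Fin.cons_succ]
        exact (dist_comm _ _).trans_le (hwb b)
      · simp only [Fin.cons_zero, Fin.cons_succ]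
        exact hwb a
      · simp only [Fin.cons_succ]
        exact (hw a b).trans hn
    · refine Fin.cases ⟨_, rfl⟩ (fun a => ?_) a
      simpa only [Fin.cons_succ] using hw' a

lemma affineSubdivision_iterate_mem_supported {k : ℕ} (n m : ℕ) {v : Fin (n + 1) → Simplex k}
    {D : ℝ} (h : ∀ i j, dist (v i) (v j) ≤ D) :
    (affineSubdivision n)^[m] (Finsupp.single v 1) ∈ Finsupp.supported ℤ ℤ
      {w : Fin (n + 1) → Simplex k | ∀ i j, dist (w i) (w j) ≤ (n / (n + 1) : ℝ) ^ m * D} := by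
  induction m with
  | zero =>
    refine single_mem_supported_iff.2 fun i j => ?_
    simpa using h i j
  | succ m ih =>
    rw [Function.iterate_succ_apply']
    refine map_mem_of_mem_supported _ _ (fun w hw => ?_) ih
    refine Finsupp.supported_mono ?_ (affineSubdivision_single_mem_supported n hw)
    rintro u ⟨hu, -⟩
    intro i j
    rw [pow_succ', mul_assoc]
    exact hu i j

lemma dist_affineSimplex_affineSimplex_le {k n : ℕ} {v : Fin (n + 1) → Simplex k} {D : ℝ}
    (h : ∀ i j, dist (v i) (v j) ≤ D) (s t : Simplex n) :
    dist (affineSimplex v s) (affineSimplex v t) ≤ D :=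
  dist_affineSimplex_le (fun i => (dist_comm _ _).trans_le
    (dist_affineSimplex_le (fun j => h j i) t)) s

lemma dist_simplex_le_one {k : ℕ} (s t : Simplex k) : dist s t ≤ 1 :=
  (dist_pi_le_iff zero_le_one).2 fun i => Real.dist_le_of_mem_Icc_01
    ⟨s.2.1 i, stdSimplex.le_one s i⟩ ⟨t.2.1 i, stdSimplex.le_one t i⟩

/-! ### Subdivision of singular chains -/

lemma subdivision_iterate_single [TopologicalSpace X] {n : ℕ} (σ : C(Simplex n, X)) (m : ℕ) :
    subdivision^[m] (Finsupp.single σ 1) = pushforward σ (affineToSingular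
      ((affineSubdivision n)^[m] (Finsupp.single (fun i => stdSimplex.vertex i) 1))) := by
  induction m with
  | zero => simp [affineSimplex_vertices]
  | succ m ih =>
    rw [Function.iterate_succ_apply', ih, subdivision_pushforward, subdivision_affineToSingular,
      Function.iterate_succ_apply']

lemma subdivision_iterate_eq_pow [TopologicalSpace X] {n : ℕ} (c : Chain X n) (m : ℕ) :
    subdivision^[m] c = ((subdivision : Chain X n →ₗ[ℤ] Chain X n) ^ m) c :=
  (Module.End.pow_apply _ m c).symm

-- The affine pieces have diameter at most `(n / (n + 1)) ^ m`, and `σ` is uniformly continuous on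
-- the compact simplex. The eventual form gives a common `m` for finitely many simplices.
open Filter in
lemma eventually_subdivision_iterate_single_mem_supported [MetricSpace X] {n : ℕ}
    (σ : C(Simplex n, X)) {δ : ℝ} (hδ : 0 < δ) :
    ∀ᶠ m in atTop, subdivision^[m] (Finsupp.single σ 1) ∈ Finsupp.supported ℤ ℤ
      {τ : C(Simplex n, X) | Set.range τ ⊆ Set.range σ ∧ ∀ s t, dist (τ s) (τ t) ≤ δ} := by
  obtain ⟨η, hη, hση⟩ := Metric.uniformContinuous_iff.1
    (CompactSpace.uniformContinuous_of_continuous σ.continuous) δ hδ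
  have hn : (n / (n + 1) : ℝ) < 1 := (div_lt_one (by positivity)).2 (lt_add_one _)
  have hlim := tendsto_pow_atTop_nhds_zero_of_lt_one (by positivity) hn
  filter_upwards [hlim.eventually (gt_mem_nhds hη)] with m hm
  rw [subdivision_iterate_single]
  refine map_mem_of_mem_supported ((pushforward σ).comp affineToSingular) _ (fun w hw => ?_)
    (affineSubdivision_iterate_mem_supported n m fun i j => dist_simplex_le_one _ _)
  rw [LinearMap.comp_apply, affineToSingular_single, pushforward_single]
  refine single_mem_supported_iff.2 ⟨?_, fun s t => ?_⟩
  · rintro _ ⟨s, rfl⟩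
    exact ⟨_, rfl⟩
  · refine (hση ((dist_affineSimplex_affineSimplex_le hw s t).trans_lt ?_)).le
    rwa [mul_one]

open Filter in
/-- Iterated barycentric subdivision makes the simplices of a chain arbitrarily small. -/
lemma exists_subdivision_iterate_mem_supported [MetricSpace X] {n : ℕ} (c : Chain X n) {δ : ℝ}
    (hδ : 0 < δ) :
    ∃ m, subdivision^[m] c ∈ Finsupp.supported ℤ ℤ
      {τ : C(Simplex n, X) | Set.range τ ⊆ image c ∧ ∀ s t, dist (τ s) (τ t) ≤ δ} := by
  have := (eventually_all_finset c.support).2 fun σ _ =>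
    eventually_subdivision_iterate_single_mem_supported σ hδ
  obtain ⟨m, hm⟩ := this.exists
  refine ⟨m, ?_⟩
  rw [subdivision_iterate_eq_pow]
  refine map_mem_of_mem_supported (s := c.support) _ _ (fun σ hσ => ?_)
    ((Finsupp.mem_supported ℤ c).2 subset_rfl)
  rw [← subdivision_iterate_eq_pow]
  refine Finsupp.supported_mono ?_ (hm σ hσ)
  rintro τ ⟨hτ, hd⟩
  exact ⟨hτ.trans (Set.subset_biUnion_of_mem (u := fun τ : C(Simplex n, X) => Set.range τ) hσ), hd⟩

/-! ### Lipschitz chains -/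

lemma lipschitzWith_affineSimplex {k n : ℕ} (v : Fin (n + 1) → Simplex k) :
    LipschitzWith (n + 1) (affineSimplex v) := by
  refine LipschitzWith.of_dist_le_mul fun s t => ?_
  refine (dist_pi_le_iff (by positivity)).2 fun a => ?_
  change |affineSimplex v s a - affineSimplex v t a| ≤ _
  rw [affineSimplex_apply, affineSimplex_apply, ← Finset.sum_sub_distrib]
  calc |∑ i, (s i * v i a - t i * v i a)| ≤ ∑ i, |s i * v i a - t i * v i a| :=
        Finset.abs_sum_le_sum_abs _ _
    _ ≤ ∑ _i : Fin (n + 1), dist s t := by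
        refine Finset.sum_le_sum fun i _ => ?_
        rw [← sub_mul, abs_mul]
        refine (mul_le_of_le_one_right (abs_nonneg _) ?_).trans
          (dist_le_pi_dist (s : Fin (n + 1) → ℝ) t i)
        exact (abs_of_nonneg ((v i).2.1 a)).trans_le (stdSimplex.le_one (v i) a)
    _ = _ := by simp

lemma lipschitzWith_face {n : ℕ} (j : Fin (n + 2)) : LipschitzWith (n + 1) (face j) := by
  have := affineSimplex_comp_face (fun i : Fin (n + 2) => stdSimplex.vertex i) j
  rw [affineSimplex_vertices, ContinuousMap.id_comp] at this
  rw [this]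
  exact lipschitzWith_affineSimplex _

lemma boundary_mem_lipschitzChains [MetricSpace X] {n : ℕ} {c : Chain X (n + 1)}
    (hc : c ∈ lipschitzChains X (n + 1)) : boundary c ∈ lipschitzChains X n :=
  boundary_mem_supported (s := {σ | ∃ K : NNReal, LipschitzWith K σ})
    (t := {σ | ∃ K : NNReal, LipschitzWith K σ})
    (fun _ ⟨_, hK⟩ j => ⟨_, hK.comp (lipschitzWith_face j)⟩) hc

/-- The simplices of `sd σ` are composites of `σ` with affine, hence Lipschitz, maps. -/
lemma subdivision_mem_lipschitzChains [MetricSpace X] {n : ℕ} {c : Chain X n}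
    (hc : c ∈ lipschitzChains X n) : subdivision c ∈ lipschitzChains X n := by
  refine map_mem_of_mem_supported subdivision _
    (s := {σ | ∃ K : NNReal, LipschitzWith K σ}) (fun σ ⟨K, hK⟩ => ?_) hc
  rw [subdivision_single, one_smul]
  refine map_mem_of_mem_supported ((pushforward σ).comp affineToSingular) _ (s := Set.univ)
    (fun w _ => ?_) (by simp)
  rw [LinearMap.comp_apply, affineToSingular_single, pushforward_single]
  exact single_mem_supported_iff.2 ⟨_, hK.comp (lipschitzWith_affineSimplex w)⟩

lemma lipschitzChains_zero (X : Type*) [MetricSpace X] : lipschitzChains X 0 = ⊤ := by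
  have : {σ : C(Simplex 0, X) | ∃ K : NNReal, LipschitzWith K σ} = Set.univ :=
    Set.eq_univ_of_forall fun σ => ⟨0, LipschitzWith.of_dist_le_mul fun s t => by
      simp [Subsingleton.elim s t]⟩
  rw [lipschitzChains, this, Finsupp.supported_univ]

lemma HasLipschitzBoundary.subdivision_iterate [MetricSpace X] {n : ℕ} {c : Chain X n}
    (hc : HasLipschitzBoundary c) (m : ℕ) : HasLipschitzBoundary (subdivision^[m] c) := by
  cases n with
  | zero => trivial
  | succ n =>
    induction m with
    | zero => exact hc
    | succ m ih =>
      rw [Function.iterate_succ_apply']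
      change boundary (subdivision _) ∈ _
      rw [boundary_subdivision]
      exact subdivision_mem_lipschitzChains ih

end

end SingLip

namespace SingLip

noncomputable section

/-! ### Cones over singular simplices

The cone `[0, 1] × Δᵏ → Δᵏ⁺¹` has no Lipschitz inverse near its apex. Since the part of the simplex
near the apex may be mapped to a point, it is enough to have Lipschitz maps `coneTime` and `coneBase`
which give the coordinates of the cone away from the apex. -/

lemma abs_div_sub_div_le {a b p q : ℝ} (hp : 1 / 2 ≤ p) (hq : 1 / 2 ≤ q) (hb : 0 ≤ b)
    (hbq : b ≤ q) : |a / p - b / q| ≤ 2 * |a - b| + 2 * |p - q| := by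
  have hp' : 0 < p := by linarith
  have hq' : 0 < q := by linarith
  have e : a / p - b / q = p⁻¹ * (a - b) + p⁻¹ * ((b / q) * (q - p)) := by
    field_simp
    ring
  have hpi : p⁻¹ ≤ 2 := by
    rw [inv_le_comm₀ hp' two_pos]
    linarith
  rw [e]
  refine (abs_add_le _ _).trans (add_le_add ?_ ?_)
  · rw [abs_mul, abs_of_pos (inv_pos.2 hp')]
    gcongr
  · rw [abs_mul, abs_of_pos (inv_pos.2 hp'), abs_mul, abs_of_nonneg (by positivity), abs_sub_comm q]
    have : b / q ≤ 1 := (div_le_one hq').2 hbq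
    gcongr
    exact mul_le_of_le_one_left (abs_nonneg _) this

/-- A Lipschitz function on `Δᵏ⁺¹` which is `1` on the base and vanishes near the apex `e₀`. -/
def coneTime {k : ℕ} (u : Simplex (k + 1)) : unitInterval :=
  ⟨max 0 (1 - 2 * u 0), le_max_left _ _,
    max_le zero_le_one (by linarith [stdSimplex.zero_le u 0])⟩

/-- With `a = u 0`, the left side is the sum of the numerators of `coneBase`. The extra term near
the apex keeps this sum at least `1 / 2`, so that normalising remains Lipschitz. -/
lemma coneBase_aux {a : ℝ} : max 0 (2 * a - 1) + (1 - a) = max (1 - a) a := by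
  rcases le_total a (1 / 2) with h | h
  · rw [max_eq_left (by linarith), max_eq_left (by linarith), zero_add]
  · rw [max_eq_right (by linarith), max_eq_right (by linarith)]
    ring

lemma half_le_max_one_sub (a : ℝ) : 1 / 2 ≤ max (1 - a) a := by
  rcases le_total a (1 / 2) with h | h
  · exact le_max_of_le_left (by linarith)
  · exact le_max_of_le_right h

lemma sum_simplex_succ {k : ℕ} (u : Simplex (k + 1)) : ∑ i : Fin (k + 1), u i.succ = 1 - u 0 := by
  have := stdSimplex.sum_eq_one u
  rw [Fin.sum_univ_succ] at this
  linarith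

/-- The numerators of the coordinates of `coneBase`. -/
def coneNumerator {k : ℕ} (u : Simplex (k + 1)) (i : Fin (k + 1)) : ℝ :=
  u i.succ + if i = 0 then max 0 (2 * u 0 - 1) else 0

lemma coneNumerator_nonneg {k : ℕ} (u : Simplex (k + 1)) (i : Fin (k + 1)) :
    0 ≤ coneNumerator u i := by
  have : 0 ≤ u i.succ := stdSimplex.zero_le u _
  rw [coneNumerator]
  split_ifs <;> positivity

lemma sum_coneNumerator {k : ℕ} (u : Simplex (k + 1)) :
    ∑ i, coneNumerator u i = max (1 - u 0) (u 0) := by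
  simp only [coneNumerator, Finset.sum_add_distrib, sum_simplex_succ, Finset.sum_ite_eq',
    Finset.mem_univ, if_true]
  rw [add_comm, coneBase_aux]

lemma coneNumerator_le {k : ℕ} (u : Simplex (k + 1)) (i : Fin (k + 1)) :
    coneNumerator u i ≤ max (1 - u 0) (u 0) := by
  rw [← sum_coneNumerator]
  exact Finset.single_le_sum (fun j _ => coneNumerator_nonneg u j) (Finset.mem_univ i)

/-- A Lipschitz map `Δᵏ⁺¹ → Δᵏ`, which is the projection from the apex `e₀` on the half of `Δᵏ⁺¹`
next to the base. -/
def coneBase {k : ℕ} (u : Simplex (k + 1)) : Simplex k :=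
  ⟨fun i => coneNumerator u i / max (1 - u 0) (u 0),
    fun i => div_nonneg (coneNumerator_nonneg u i)
      ((one_half_pos.le).trans (half_le_max_one_sub _)),
    by
      rw [← Finset.sum_div, sum_coneNumerator]
      exact div_self (one_half_pos.trans_le (half_le_max_one_sub _)).ne'⟩

lemma coneBase_apply {k : ℕ} (u : Simplex (k + 1)) (i : Fin (k + 1)) :
    coneBase u i = coneNumerator u i / max (1 - u 0) (u 0) := rfl

lemma coneBase_apply_of_le {k : ℕ} {u : Simplex (k + 1)} (hu : u 0 ≤ 1 / 2) (i : Fin (k + 1)) :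
    coneBase u i = u i.succ / (1 - u 0) := by
  rw [coneBase_apply, coneNumerator, max_eq_left (by linarith : u 0 ≤ 1 - u 0),
    max_eq_left (by linarith : 2 * u 0 - 1 ≤ 0), ite_self, add_zero]

lemma abs_sub_le_dist_simplex {k : ℕ} (u v : Simplex k) (i : Fin (k + 1)) :
    |u i - v i| ≤ dist u v :=
  dist_le_pi_dist (u : Fin (k + 1) → ℝ) v i

lemma lipschitzWith_coneTime {k : ℕ} : LipschitzWith 2 (coneTime (k := k)) := by
  refine LipschitzWith.of_dist_le_mul fun u v => ?_
  change |max 0 (1 - 2 * u 0) - max 0 (1 - 2 * v 0)| ≤ _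
  refine (abs_max_sub_max_le_max _ _ _ _).trans ?_
  have := abs_sub_le_dist_simplex u v 0
  rw [sub_self, abs_zero, show 1 - 2 * u 0 - (1 - 2 * v 0) = (-2) * (u 0 - v 0) by ring, abs_mul]
  simp only [abs_neg, Nat.abs_ofNat]
  refine max_le (by positivity) ?_
  push_cast
  linarith

lemma lipschitzWith_coneBase {k : ℕ} : LipschitzWith 8 (coneBase (k := k)) := by
  refine LipschitzWith.of_dist_le_mul fun u v => ?_
  refine (dist_pi_le_iff (by positivity)).2 fun i => ?_
  change |coneBase u i - coneBase v i| ≤ _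
  rw [coneBase_apply, coneBase_apply]
  refine (abs_div_sub_div_le (half_le_max_one_sub _) (half_le_max_one_sub _)
    (coneNumerator_nonneg _ _) (coneNumerator_le _ _)).trans ?_
  have h0 := abs_sub_le_dist_simplex u v 0
  have hi := abs_sub_le_dist_simplex u v i.succ
  have hden : |max (1 - u 0) (u 0) - max (1 - v 0) (v 0)| ≤ dist u v := by
    refine (abs_max_sub_max_le_max _ _ _ _).trans (max_le ?_ h0)
    rw [show 1 - u 0 - (1 - v 0) = -(u 0 - v 0) by ring, abs_neg]
    exact h0
  have hmax : |max 0 (2 * u 0 - 1) - max 0 (2 * v 0 - 1)| ≤ 2 * dist u v := by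
    refine (abs_max_sub_max_le_max _ _ _ _).trans (max_le (by simp) ?_)
    rw [show 2 * u 0 - 1 - (2 * v 0 - 1) = 2 * (u 0 - v 0) by ring, abs_mul, Nat.abs_ofNat]
    linarith
  have hnum : |coneNumerator u i - coneNumerator v i| ≤ 3 * dist u v := by
    rw [coneNumerator, coneNumerator, add_sub_add_comm]
    refine (abs_add_le _ _).trans ?_
    split_ifs
    · linarith
    · rw [sub_self, abs_zero]
      linarith [dist_nonneg (x := u) (y := v)]
  push_cast
  linarith

lemma coneTime_face_zero {k : ℕ} (x : Simplex k) : coneTime (face 0 x) = 1 := by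
  ext
  change max 0 (1 - 2 * face 0 x 0) = 1
  simp [face_apply_self]

lemma coneBase_face_zero {k : ℕ} (x : Simplex k) : coneBase (face 0 x) = x := by
  ext i
  change coneBase (face 0 x) i = x i
  have h := face_apply_succAbove 0 x i
  rw [Fin.zero_succAbove] at h
  rw [coneBase_apply_of_le (by simp [face_apply_self]), h, face_apply_self]
  simp

lemma face_succ_apply_zero {k : ℕ} (j : Fin (k + 2)) (x : Simplex (k + 1)) :
    face j.succ x 0 = x 0 := by
  have h := face_apply_succAbove j.succ x 0
  rwa [Fin.succ_succAbove_zero] at h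

lemma coneTime_face_succ {k : ℕ} (j : Fin (k + 2)) (x : Simplex (k + 1)) :
    coneTime (face j.succ x) = coneTime x := by
  ext
  change max 0 (1 - 2 * face j.succ x 0) = max 0 (1 - 2 * x 0)
  rw [face_succ_apply_zero]

lemma coneTime_eq_zero {k : ℕ} {u : Simplex (k + 1)} (hu : 1 / 2 ≤ u 0) : coneTime u = 0 := by
  ext
  exact max_eq_left (by linarith)

/-- Nearer the apex the extra weight on coordinate `0` breaks compatibility with faces; this is
harmless, as `coneTime` vanishes there. -/
lemma coneBase_face_succ {k : ℕ} (j : Fin (k + 2)) {x : Simplex (k + 1)} (hx : x 0 ≤ 1 / 2) :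
    coneBase (face j.succ x) = face j (coneBase x) := by
  ext i
  change coneBase (face j.succ x) i = face j (coneBase x) i
  rw [coneBase_apply_of_le (by rwa [face_succ_apply_zero]), face_succ_apply_zero]
  refine Fin.succAboveCases j ?_ (fun l => ?_) i
  · rw [face_apply_self, face_apply_self, zero_div]
  · rw [face_apply_succAbove, coneBase_apply_of_le hx, ← Fin.succ_succAbove_succ,
      face_apply_succAbove]

/-- The inclusion of a subset, as a continuous map. -/
def inclusion {X : Type*} [TopologicalSpace X] (S : Set X) : C(S, X) :=
  ⟨Subtype.val, continuous_subtype_val⟩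

section Cone

variable {X : Type*} [TopologicalSpace X] {S : Set X} (φ : C(unitInterval × S, X))

/-- The cone over a singular simplex `σ` of `S`, for a contraction `φ` of `S` in `X`. -/
def coneSimplex {k : ℕ} (σ : C(Simplex k, S)) : C(Simplex (k + 1), X) :=
  φ.comp (ContinuousMap.prodMk ⟨coneTime, lipschitzWith_coneTime.continuous⟩
    (σ.comp ⟨coneBase, lipschitzWith_coneBase.continuous⟩))

lemma coneSimplex_apply {k : ℕ} (σ : C(Simplex k, S)) (u : Simplex (k + 1)) :
    coneSimplex φ σ u = φ (coneTime u, σ (coneBase u)) := rfl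

/-- The cone over a singular chain of `S`, for a contraction `φ` of `S` in `X`. -/
def coneChain {k : ℕ} : Chain S k →ₗ[ℤ] Chain X (k + 1) :=
  Finsupp.lmapDomain ℤ ℤ (coneSimplex φ)

@[simp]
lemma coneChain_single {k : ℕ} (σ : C(Simplex k, S)) (a : ℤ) :
    coneChain φ (Finsupp.single σ a) = Finsupp.single (coneSimplex φ σ) a := by
  simp [coneChain]

variable {φ}

lemma coneSimplex_comp_face_zero (h₁ : ∀ s, φ (1, s) = s) {k : ℕ} (σ : C(Simplex k, S)) :
    (coneSimplex φ σ).comp (face 0) = (inclusion S).comp σ := by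
  ext1 x
  simp only [ContinuousMap.comp_apply, coneSimplex_apply, coneTime_face_zero, coneBase_face_zero,
    h₁]
  rfl

/-- On the half next to the base `coneBase` commutes with faces; on the half next to the apex both
sides are the constant `x₀`. -/
lemma coneSimplex_comp_face_succ {x₀ : X} (h₀ : ∀ s, φ (0, s) = x₀) {k : ℕ}
    (σ : C(Simplex (k + 1), S)) (j : Fin (k + 2)) :
    (coneSimplex φ σ).comp (face j.succ) = coneSimplex φ (σ.comp (face j)) := by
  ext1 x
  simp only [ContinuousMap.comp_apply, coneSimplex_apply, coneTime_face_succ]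
  rcases le_total (x 0) (1 / 2) with h | h
  · rw [coneBase_face_succ j h]
  · rw [coneTime_eq_zero h, h₀, h₀]

lemma boundary_coneChain_succ {x₀ : X} (h₀ : ∀ s, φ (0, s) = x₀) (h₁ : ∀ s, φ (1, s) = s) {k : ℕ}
    (c : Chain S (k + 1)) :
    boundary (coneChain φ c) = pushforward (inclusion S) c - coneChain φ (boundary c) := by
  induction c using Finsupp.induction_linear with
  | zero => simp
  | add c d hc hd => simp only [map_add, hc, hd]; abel
  | single σ a =>
    rw [coneChain_single, boundary_single, boundary_single, Fin.sum_univ_succ, map_smul,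
      map_sum, smul_add, sub_eq_add_neg, pushforward_single]
    congr 1
    · simp only [Fin.val_zero, pow_zero, Finsupp.smul_single, smul_eq_mul, mul_one,
        coneSimplex_comp_face_zero h₁]
    · rw [← smul_neg, ← Finset.sum_neg_distrib]
      congr 1
      refine Finset.sum_congr rfl fun j _ => ?_
      rw [coneChain_single, ← Finsupp.single_neg, Fin.val_succ, pow_succ, mul_neg_one,
        coneSimplex_comp_face_succ h₀]

lemma boundary_coneChain_zero {x₀ : X} (h₀ : ∀ s, φ (0, s) = x₀) (h₁ : ∀ s, φ (1, s) = s)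
    (c : Chain S 0) :
    boundary (coneChain φ c) =
      pushforward (inclusion S) c - Finsupp.single (ContinuousMap.const _ x₀) (degree c) := by
  induction c using Finsupp.induction_linear with
  | zero => simp
  | add c d hc hd => simp only [map_add, hc, hd, Finsupp.single_add]; abel
  | single σ a =>
    rw [coneChain_single, boundary_single, Fin.sum_univ_two, degree_single, smul_add,
      sub_eq_add_neg, pushforward_single, Finsupp.smul_single, Finsupp.smul_single,
      ← Finsupp.single_neg, coneSimplex_comp_face_zero h₁]
    congr 1
    · simp
    · congr 1
      · ext1 x
        have h : face 1 x 0 = 1 := by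
          have h' := face_apply_succAbove 1 x 0
          rw [Fin.one_succAbove_zero] at h'
          rw [h']
          have := stdSimplex.sum_eq_one x
          rwa [Fin.sum_univ_one] at this
        rw [ContinuousMap.comp_apply, coneSimplex_apply, coneTime_eq_zero (by rw [h]; norm_num), h₀]
        rfl
      · simp

end Cone

/-! ### Passing between chains of a subset and chains of the whole space. -/

lemma inclusion_comp_injective {X : Type*} [TopologicalSpace X] (S : Set X) (n : ℕ) :
    Function.Injective fun σ : C(Simplex n, S) => (inclusion S).comp σ :=
  fun _ _ h => ContinuousMap.ext fun s => Subtype.ext (DFunLike.congr_fun h s)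

/-- The restriction to `S` of singular chains of `X`; simplices outside `S` are dropped. -/
def restrict {X : Type*} [TopologicalSpace X] (S : Set X) {n : ℕ} (c : Chain X n) : Chain S n :=
  Finsupp.comapDomain (fun σ : C(Simplex n, S) => (inclusion S).comp σ) c
    (inclusion_comp_injective S n).injOn

lemma pushforward_inclusion_injective {X : Type*} [TopologicalSpace X] (S : Set X) (n : ℕ) :
    Function.Injective (pushforward (inclusion S) : Chain S n →ₗ[ℤ] Chain X n) :=
  Finsupp.mapDomain_injective (inclusion_comp_injective S n)

lemma pushforward_restrict {X : Type*} [TopologicalSpace X] {S : Set X} {n : ℕ} {c : Chain X n}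
    (hc : image c ⊆ S) : pushforward (inclusion S) (restrict S c) = c := by
  refine Finsupp.mapDomain_comapDomain _ (inclusion_comp_injective S n) c fun σ hσ => ?_
  have hσ' : Set.range σ ⊆ S := mem_chainsIn_iff.2 hc hσ
  exact ⟨⟨fun s => ⟨σ s, hσ' ⟨s, rfl⟩⟩, by fun_prop⟩, rfl⟩

lemma restrict_mem_lipschitzChains {X : Type*} [MetricSpace X] {S : Set X} {n : ℕ} {c : Chain X n}
    (hc : c ∈ lipschitzChains X n) : restrict S c ∈ lipschitzChains S n := by
  refine (Finsupp.mem_supported ℤ _).2 fun σ hσ => ?_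
  have hσ' : (inclusion S).comp σ ∈ c.support := by
    rw [restrict, Finsupp.comapDomain_support] at hσ
    simpa using hσ
  obtain ⟨K, hK⟩ := (Finsupp.mem_supported ℤ c).1 hc hσ'
  exact ⟨K, hK⟩

lemma degree_pushforward {X Y : Type*} [TopologicalSpace X] [TopologicalSpace Y] (f : C(X, Y))
    {n : ℕ} (c : Chain X n) : degree (pushforward f c) = degree c := by
  induction c using Finsupp.induction_linear with
  | zero => simp
  | add c d hc hd => simp only [map_add, hc, hd]
  | single σ a => simp

/-! ### Filling cycles -/

/-- Cycles of the augmented singular chain complex. -/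
def IsReducedCycle {X : Type*} [TopologicalSpace X] : {n : ℕ} → Chain X n → Prop
  | 0, z => degree z = 0
  | _ + 1, z => boundary z = 0

lemma isReducedCycle_boundary {X : Type*} [TopologicalSpace X] {n : ℕ} (c : Chain X (n + 1)) :
    IsReducedCycle (boundary c) := by
  cases n with
  | zero => exact degree_boundary c
  | succ n => exact boundary_boundary c

lemma coneChain_mem_lipschitzChains {X : Type*} [MetricSpace X] {S : Set X}
    {φ : C(unitInterval × S, X)} {K : NNReal} (hφ : LipschitzWith K φ) {n : ℕ} {c : Chain S n}
    (hc : c ∈ lipschitzChains S n) : coneChain φ c ∈ lipschitzChains X (n + 1) := by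
  refine map_mem_of_mem_supported (coneChain φ) _ (s := {σ | ∃ K : NNReal, LipschitzWith K σ})
    (fun σ ⟨K', hK'⟩ => ?_) hc
  rw [coneChain_single]
  exact single_mem_supported_iff.2
    ⟨_, hφ.comp (lipschitzWith_coneTime.prodMk (hK'.comp lipschitzWith_coneBase))⟩

/-- The final bound compares times `t` and `1`; it controls how far a cone leaves its base. -/
lemma AdmitsStrongLipschitzContraction.exists_lipschitz {X : Type*} [MetricSpace X] {γ : ℝ}
    (hγ : 0 ≤ γ) {S : Set X} (h : AdmitsStrongLipschitzContraction γ S) :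
    ∃ (φ : C(unitInterval × S, X)) (x₀ : X) (K : NNReal), LipschitzWith K φ ∧
      (∀ s, φ (0, s) = x₀) ∧ (∀ s, φ (1, s) = s) ∧
      ∀ t s, dist (φ (t, s)) s ≤ γ * Metric.diam S := by
  obtain ⟨φ, x₀, h₁, h₀, hφ⟩ := h
  have hD : 0 ≤ γ * Metric.diam S := mul_nonneg hγ Metric.diam_nonneg
  have hL : LipschitzWith (⟨γ * Metric.diam S, hD⟩ + ⟨γ, hγ⟩ : NNReal)
      (fun p : unitInterval × S => φ p.1 p.2) := by
    refine LipschitzWith.of_dist_le_mul fun p q => (hφ _ _ _ _).trans ?_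
    change _ ≤ (γ * Metric.diam S + γ) * _
    rw [add_mul]
    have h1 : dist p.1 q.1 ≤ dist p q := le_max_left _ _
    have h2 : dist p.2 q.2 ≤ dist p q := le_max_right _ _
    gcongr
  refine ⟨⟨_, hL.continuous⟩, x₀, _, hL, h₀, h₁, fun t s => ?_⟩
  change dist (φ t s) s ≤ _
  calc dist (φ t s) s = dist (φ t s) (φ 1 s) := by rw [h₁]
    _ ≤ γ * Metric.diam S * dist t 1 + γ * dist s s := hφ _ _ _ _
    _ ≤ γ * Metric.diam S := by
      rw [dist_self, mul_zero, add_zero]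
      exact mul_le_of_le_one_right hD (Real.dist_le_of_mem_Icc_01 t.2 (1 : unitInterval).2)

/-- A reduced cycle in a small ball has a filling in a ball that is only a little larger; it is
Lipschitz if the cycle is. -/
lemma exists_filling {X : Type*} [MetricSpace X] {γ r R : ℝ} (hγ : 0 ≤ γ) {y : X}
    (hU : ∀ U ⊆ Metric.ball y r, AdmitsStrongLipschitzContraction γ U) (hR : 0 ≤ R) (hRr : R < r)
    {n : ℕ} {z : Chain X n} (hz : IsReducedCycle z) (him : image z ⊆ Metric.closedBall y R) :
    ∃ w : Chain X (n + 1), boundary w = z ∧ image w ⊆ Metric.closedBall y ((1 + 2 * γ) * R) ∧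
      (z ∈ lipschitzChains X n → w ∈ lipschitzChains X (n + 1)) := by
  obtain ⟨S, hSdef⟩ : ∃ S, S = Metric.closedBall y R := ⟨_, rfl⟩
  rw [← hSdef] at him
  obtain ⟨φ, x₀, K, hK, h₀, h₁, hd⟩ :=
    (hU S (hSdef ▸ Metric.closedBall_subset_ball hRr)).exists_lipschitz hγ
  -- A cone moves points by at most `γ * diam S ≤ 2 * γ * R`, whence the radius `(1 + 2 * γ) * R`.
  have hS : Metric.diam S ≤ 2 * R := hSdef ▸ Metric.diam_closedBall hR
  have hres := pushforward_restrict him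
  refine ⟨coneChain φ (restrict S z), ?_, ?_, fun h =>
    coneChain_mem_lipschitzChains hK (restrict_mem_lipschitzChains h)⟩
  · cases n with
    | zero =>
      have : degree (restrict S z) = 0 := by
        rw [← degree_pushforward (inclusion S), hres]
        exact hz
      rw [boundary_coneChain_zero h₀ h₁, this, hres, Finsupp.single_zero, sub_zero]
    | succ n =>
      have : boundary (restrict S z) = 0 := by
        apply pushforward_inclusion_injective S n
        rw [← boundary_pushforward, hres, map_zero]
        exact hz
      rw [boundary_coneChain_succ h₀ h₁, this, hres, map_zero, sub_zero]
  · refine mem_chainsIn_iff.1 (map_mem_of_mem_supported (coneChain φ) _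
      (s := Set.univ) (fun σ _ => ?_) (by simp))
    rw [coneChain_single]
    refine single_mem_supported_iff.2 ?_
    rintro _ ⟨u, rfl⟩
    have h2 := hd (coneTime u) (σ (coneBase u))
    have h3 : dist (σ (coneBase u) : X) y ≤ R := hSdef.subset (σ (coneBase u)).2
    rw [Metric.mem_closedBall, coneSimplex_apply]
    have := dist_triangle (φ (coneTime u, σ (coneBase u))) (σ (coneBase u)) y
    nlinarith

end

end SingLip

namespace SingLip

noncomputable section

/-! ### Approximation by Lipschitz chains -/

variable {X : Type*} [MetricSpace X]

lemma AdmitsStrongLipschitzContraction.mono {γ γ' : ℝ} (hγ : γ ≤ γ') {S : Set X}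
    (h : AdmitsStrongLipschitzContraction γ S) : AdmitsStrongLipschitzContraction γ' S := by
  obtain ⟨φ, x₀, h₁, h₀, hφ⟩ := h
  refine ⟨φ, x₀, h₁, h₀, fun t t' s s' => (hφ t t' s s').trans ?_⟩
  have := Metric.diam_nonneg (s := S)
  gcongr

/-- On a compact set, the constants of locally strong Lipschitz contractions may be chosen
uniformly. -/
lemma AdmitsLocallyStrongLipschitzContractions.exists_uniform
    (h : AdmitsLocallyStrongLipschitzContractions X) {K : Set X} (hK : IsCompact K) :
    ∃ r : ℝ, 0 < r ∧ ∃ γ : ℝ, 0 < γ ∧ ∀ y ∈ K, ∀ U ⊆ Metric.ball y r,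
      AdmitsStrongLipschitzContraction γ U := by
  refine hK.induction_on ?_ ?_ ?_ ?_
  · exact ⟨1, one_pos, 1, one_pos, fun y hy => hy.elim⟩
  · rintro s t hst ⟨r, hr, γ, hγ, H⟩
    exact ⟨r, hr, γ, hγ, fun y hy => H y (hst hy)⟩
  · rintro s t ⟨r, hr, γ, hγ, H⟩ ⟨r', hr', γ', hγ', H'⟩
    refine ⟨min r r', lt_min hr hr', max γ γ', lt_max_of_lt_left hγ, ?_⟩
    rintro y (hy | hy) U hU
    · exact (H y hy U (hU.trans (Metric.ball_subset_ball (min_le_left _ _)))).mono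
        (le_max_left _ _)
    · exact (H' y hy U (hU.trans (Metric.ball_subset_ball (min_le_right _ _)))).mono
        (le_max_right _ _)
  · intro x _
    obtain ⟨r, hr, γ, hγ, H⟩ := h x
    -- Halving the radius keeps a ball of radius `r / 2` about any nearby `y` inside the ball of
    -- radius `r` about `x`.
    refine ⟨Metric.ball x (r / 2), mem_nhdsWithin_of_mem_nhds (Metric.ball_mem_nhds _ (by positivity)),
      r / 2, by positivity, γ, hγ, fun y hy U hU => H U (hU.trans ?_)⟩
    refine Metric.ball_subset_ball' ?_
    linarith [Metric.mem_ball.1 hy]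

lemma isCompact_image {n : ℕ} (c : Chain X n) : IsCompact (image c) :=
  c.support.isCompact_biUnion fun σ _ => isCompact_range σ.continuous

lemma chainsIn_mono {A B : Set X} (h : A ⊆ B) (n : ℕ) : chainsIn A n ≤ chainsIn B n :=
  Finsupp.supported_mono fun _ hσ => Set.Subset.trans hσ h

lemma boundary_mem_chainsIn {A : Set X} {n : ℕ} {c : Chain X (n + 1)} (hc : c ∈ chainsIn A (n + 1)) :
    boundary c ∈ chainsIn A n :=
  boundary_mem_supported (s := {σ | Set.range σ ⊆ A}) (t := {σ | Set.range σ ⊆ A})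
    (fun σ (hσ : Set.range σ ⊆ A) j => (Set.range_comp_subset_range (face j) σ).trans hσ) hc

/-- The singular simplices in `K` of diameter at most `δ`. -/
def smallSimplices (K : Set X) (δ : ℝ) (n : ℕ) : Set C(Simplex n, X) :=
  {τ | Set.range τ ⊆ K ∧ ∀ s t, dist (τ s) (τ t) ≤ δ}

lemma comp_face_mem_smallSimplices {K : Set X} {δ : ℝ} {n : ℕ} {τ : C(Simplex (n + 1), X)}
    (hτ : τ ∈ smallSimplices K δ (n + 1)) (j : Fin (n + 2)) :
    τ.comp (face j) ∈ smallSimplices K δ n :=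
  ⟨(Set.range_comp_subset_range (face j) τ).trans hτ.1, fun _ _ => hτ.2 _ _⟩

/-- A chain homotopy from the small simplices to Lipschitz chains, relative to the Lipschitz
simplices, that moves no simplex by more than `ρ`. -/
structure LipschitzApproximation (K : Set X) (δ ρ : ℝ) (n : ℕ) where
  homotopy : Chain X n →ₗ[ℤ] Chain X (n + 1)
  approx : Chain X n →ₗ[ℤ] Chain X n
  boundary_homotopy : ∀ z ∈ Finsupp.supported ℤ ℤ (smallSimplices K δ n), HasLipschitzBoundary z →
    boundary (homotopy z) = z - approx z
  approx_mem : ∀ z ∈ Finsupp.supported ℤ ℤ (smallSimplices K δ n), approx z ∈ lipschitzChains X n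
  homotopy_eq_zero : ∀ z ∈ Finsupp.supported ℤ ℤ (smallSimplices K δ n),
    z ∈ lipschitzChains X n → homotopy z = 0
  homotopy_mem : ∀ τ ∈ smallSimplices K δ n, ∀ s,
    homotopy (Finsupp.single τ 1) ∈ chainsIn (Metric.closedBall (τ s) ρ) (n + 1)

/-- In dimension `0` all chains are Lipschitz. -/
def LipschitzApproximation.zero (K : Set X) (δ ρ : ℝ) : LipschitzApproximation K δ ρ 0 where
  homotopy := 0
  approx := LinearMap.id
  boundary_homotopy z _ _ := by simp
  approx_mem z _ := by simp [lipschitzChains_zero]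
  homotopy_eq_zero z _ _ := rfl
  homotopy_mem τ _ s := Submodule.zero_mem _

lemma single_mem_lipschitzChains_iff {n : ℕ} {τ : C(Simplex n, X)} :
    Finsupp.single τ 1 ∈ lipschitzChains X n ↔ ∃ K : NNReal, LipschitzWith K τ :=
  single_mem_supported_iff

/-- The values of the next homotopy and approximation on a single simplex: the approximation fills
the approximation of the boundary, and the homotopy fills the resulting cycle. -/
lemma LipschitzApproximation.exists_extension {K : Set X} {δ ρ r γ : ℝ} {n : ℕ}
    (Φ : LipschitzApproximation K δ ρ n) (hδ : 0 ≤ δ) (hρ : 0 ≤ ρ) (hγ : 0 ≤ γ)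
    (hU : ∀ y ∈ K, ∀ U ⊆ Metric.ball y r, AdmitsStrongLipschitzContraction γ U)
    (hr : (1 + 2 * γ) * (ρ + δ) < r) {τ : C(Simplex (n + 1), X)}
    (hτ : τ ∈ smallSimplices K δ (n + 1)) :
    ∃ (h : Chain X (n + 2)) (l : Chain X (n + 1)),
      boundary h = Finsupp.single τ 1 - l - Φ.homotopy (boundary (Finsupp.single τ 1)) ∧
      l ∈ lipschitzChains X (n + 1) ∧
      ((∃ C : NNReal, LipschitzWith C τ) → h = 0) ∧
      ∀ s, h ∈ chainsIn
        (Metric.closedBall (τ s) ((1 + 2 * γ) * ((1 + 2 * γ) * (ρ + δ)) + δ)) (n + 2) := by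
  have hbs : boundary (Finsupp.single τ 1) ∈ Finsupp.supported ℤ ℤ (smallSimplices K δ n) :=
    boundary_mem_supported (fun _ h j => comp_face_mem_smallSimplices h j)
      (single_mem_supported_iff.2 hτ)
  by_cases hL : ∃ C : NNReal, LipschitzWith C τ
  · have hL' := single_mem_lipschitzChains_iff.2 hL
    refine ⟨0, Finsupp.single τ 1, ?_, hL', fun _ => rfl, fun s => Submodule.zero_mem _⟩
    rw [Φ.homotopy_eq_zero _ hbs (boundary_mem_lipschitzChains hL')]
    simp
  set R := ρ + δ with hR
  have hR0 : 0 ≤ R := by positivity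
  have hRR : R ≤ (1 + 2 * γ) * R := by nlinarith
  let s₀ : Simplex (n + 1) := stdSimplex.vertex 0
  set y := τ s₀
  have hUy := hU y (hτ.1 ⟨s₀, rfl⟩)
  set b := boundary (Finsupp.single τ (1 : ℤ)) with hb
  have hτy : Finsupp.single τ (1 : ℤ) ∈ chainsIn (Metric.closedBall y R) (n + 1) := by
    refine single_mem_supported_iff.2 ?_
    rintro _ ⟨s, rfl⟩
    exact (hτ.2 s s₀).trans (by linarith)
  have hHb : Φ.homotopy b ∈ chainsIn (Metric.closedBall y R) (n + 1) := by
    have : b ∈ Finsupp.supported ℤ ℤ {σ | ∃ j, σ = τ.comp (face j)} :=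
      boundary_mem_supported (s := {τ}) (t := {σ | ∃ j, σ = τ.comp (face j)})
        (fun σ (h : σ = τ) j => ⟨j, by rw [h]⟩)
        (single_mem_supported_iff.2 (Set.mem_singleton τ))
    refine map_mem_of_mem_supported Φ.homotopy _ ?_ this
    rintro _ ⟨j, rfl⟩
    refine chainsIn_mono (Metric.closedBall_subset_closedBall' ?_) _
      (Φ.homotopy_mem _ (comp_face_mem_smallSimplices hτ j) (stdSimplex.vertex 0))
    exact add_le_add_right (hτ.2 _ _) _
  -- The inductive relation applies to `b` because `b` is itself a cycle, so its boundary is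
  -- trivially Lipschitz.
  have hbb : boundary (Φ.homotopy b) = b - Φ.approx b := by
    refine Φ.boundary_homotopy b hbs ?_
    cases n with
    | zero => trivial
    | succ n =>
      change boundary b ∈ _
      rw [hb, boundary_boundary]
      exact Submodule.zero_mem _
  have hLb : Φ.approx b = boundary (Finsupp.single τ 1 - Φ.homotopy b) := by
    rw [map_sub, hbb]
    abel
  obtain ⟨l, hl, hly, hlL⟩ := exists_filling hγ hUy hR0 (hRR.trans_lt hr)
    (hLb ▸ isReducedCycle_boundary (Finsupp.single τ 1 - Φ.homotopy b))
    (hLb ▸ mem_chainsIn_iff.1 (boundary_mem_chainsIn (Submodule.sub_mem _ hτy hHb)))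
  have hcyc : IsReducedCycle (Finsupp.single τ 1 - l - Φ.homotopy b) := by
    change boundary _ = 0
    rw [map_sub, map_sub, hl, hbb, ← hb]
    abel
  have hcy : Finsupp.single τ 1 - l - Φ.homotopy b ∈
      chainsIn (Metric.closedBall y ((1 + 2 * γ) * R)) (n + 1) := by
    have hmono := chainsIn_mono (Metric.closedBall_subset_closedBall hRR : Metric.closedBall y R ⊆ _)
      (n + 1)
    exact Submodule.sub_mem _ (Submodule.sub_mem _ (hmono hτy) (mem_chainsIn_iff.2 hly))
      (hmono hHb)
  -- The second filling enlarges the radius by `1 + 2 * γ` once more; the final `+ δ` comes from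
  -- moving the center from `y` to `τ s`.
  obtain ⟨h, hh, hhy, -⟩ := exists_filling hγ hUy (by positivity) hr hcyc (mem_chainsIn_iff.1 hcy)
  refine ⟨h, l, hh, hlL (Φ.approx_mem b hbs), fun h => (hL h).elim, fun s => ?_⟩
  refine chainsIn_mono (Metric.closedBall_subset_closedBall' ?_) _ (mem_chainsIn_iff.2 hhy)
  exact add_le_add_right (hτ.2 _ _) _

/-- The values chosen on small simplices are extended linearly. -/
lemma LipschitzApproximation.nonempty_succ {K : Set X} {δ ρ r γ : ℝ} {n : ℕ}
    (Φ : LipschitzApproximation K δ ρ n) (hδ : 0 ≤ δ) (hρ : 0 ≤ ρ) (hγ : 0 ≤ γ)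
    (hU : ∀ y ∈ K, ∀ U ⊆ Metric.ball y r, AdmitsStrongLipschitzContraction γ U)
    (hr : (1 + 2 * γ) * (ρ + δ) < r) :
    Nonempty (LipschitzApproximation K δ ((1 + 2 * γ) * ((1 + 2 * γ) * (ρ + δ)) + δ) (n + 1)) := by
  have hext := fun (τ : C(Simplex (n + 1), X)) (hτ : τ ∈ smallSimplices K δ (n + 1)) =>
    Φ.exists_extension hδ hρ hγ hU hr hτ
  choose! h l hhl hlL hh0 hhm using hext
  have hH : ∀ τ, Finsupp.linearCombination ℤ h (Finsupp.single τ 1) = h τ := by simp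
  have hlin : ∀ τ, Finsupp.linearCombination ℤ l (Finsupp.single τ 1) = l τ := by simp
  refine ⟨⟨Finsupp.linearCombination ℤ h, Finsupp.linearCombination ℤ l, fun z hz hbz => ?_,
    fun z hz => ?_, fun z hz hzL => ?_, fun τ hτ s => ?_⟩⟩
  -- The full homotopy formula holds for every small chain; the Lipschitz boundary is used only to
  -- remove its last term.
  · have key : boundary (Finsupp.linearCombination ℤ h z) =
        z - Finsupp.linearCombination ℤ l z - Φ.homotopy (boundary z) := by
      have := map_mem_of_mem_supported (boundary ∘ₗ Finsupp.linearCombination ℤ h -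
        (LinearMap.id - Finsupp.linearCombination ℤ l - Φ.homotopy ∘ₗ boundary)) ⊥
        (fun τ hτ => ?_) hz
      · simpa [sub_eq_zero] using this
      · rw [Submodule.mem_bot]
        simp only [LinearMap.sub_apply, LinearMap.comp_apply, LinearMap.id_apply, hH, hlin]
        rw [hhl τ hτ, sub_self]
    have hb : boundary z ∈ Finsupp.supported ℤ ℤ (smallSimplices K δ n) :=
      boundary_mem_supported (fun _ h j => comp_face_mem_smallSimplices h j) hz
    rw [key, Φ.homotopy_eq_zero _ hb hbz, sub_zero]
  · exact map_mem_of_mem_supported _ _ (fun τ hτ => (hlin τ).symm ▸ hlL τ hτ) hz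
  · have : z ∈ Finsupp.supported ℤ ℤ
        (smallSimplices K δ (n + 1) ∩ {τ | ∃ C : NNReal, LipschitzWith C τ}) := by
      rw [Finsupp.supported_inter]
      exact ⟨hz, hzL⟩
    rw [← Submodule.mem_bot ℤ]
    refine map_mem_of_mem_supported _ _ (fun τ hτ => ?_) this
    rw [hH, hh0 τ hτ.1 hτ.2]
    exact Submodule.zero_mem _
  · rw [hH]
    exact hhm τ hτ s

/-- Each dimension replaces `A` by `(1 + 2γ)² (A + 1) + 1`. The displacement stays linear in `δ`, so
a finer subdivision makes it as small as desired. -/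
lemma exists_lipschitzApproximation {K : Set X} {r γ : ℝ} (hγ : 0 ≤ γ)
    (hU : ∀ y ∈ K, ∀ U ⊆ Metric.ball y r, AdmitsStrongLipschitzContraction γ U) (n : ℕ) :
    ∃ A : ℝ, 0 ≤ A ∧ ∀ δ, 0 ≤ δ → A * δ < r → Nonempty (LipschitzApproximation K δ (A * δ) n) := by
  induction n with
  | zero => exact ⟨0, le_rfl, fun δ _ _ => ⟨.zero K δ _⟩⟩
  | succ n ih =>
    obtain ⟨A, hA, H⟩ := ih
    refine ⟨(1 + 2 * γ) * ((1 + 2 * γ) * (A + 1)) + 1, by positivity, fun δ hδ hr => ?_⟩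
    have e : ((1 + 2 * γ) * ((1 + 2 * γ) * (A + 1)) + 1) * δ =
      (1 + 2 * γ) * ((1 + 2 * γ) * (A * δ + δ)) + δ := by ring
    rw [e] at hr ⊢
    have hAδ : 0 ≤ A * δ := by positivity
    have h1 : A * δ + δ ≤ (1 + 2 * γ) * (A * δ + δ) :=
      le_mul_of_one_le_left (by positivity) (by linarith)
    have h2 : (1 + 2 * γ) * (A * δ + δ) ≤ (1 + 2 * γ) * ((1 + 2 * γ) * (A * δ + δ)) :=
      le_mul_of_one_le_left (by positivity) (by linarith)
    obtain ⟨Φ⟩ := H δ hδ (by linarith)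
    exact Φ.nonempty_succ hδ hAδ hγ hU (by linarith)

end

end SingLip

/-! ### Decomposition of the subdivided chain. -/

open SingLip in
theorem theorem1p5 (X : Type*) [MetricSpace X] :
    SingLip.lipschitzChains X 0 = ⊤ ∧
    (SingLip.AdmitsLocallyStrongLipschitzContractions X →
      ∀ (ε : ℝ), 0 < ε → ∀ (n : ℕ) (c : SingLip.Chain X n), SingLip.HasLipschitzBoundary c →
        ∃ (N : ℕ) (ci cL : Fin N → SingLip.Chain X n) (cbar : Fin N → SingLip.Chain X (n + 1)),
          0 < N ∧
          (∀ i, cL i ∈ SingLip.lipschitzChains X n) ∧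
          (∃ m : ℕ, ∑ i, ci i = (SingLip.subdivision^[m]) c) ∧
          (∀ i, SingLip.boundary (cbar i) = ci i - cL i) ∧
          (∀ i, SingLip.image (cbar i) ⊆ Metric.thickening ε (SingLip.image c)) ∧
          (∀ i, Metric.diam (SingLip.image (cbar i)) < ε)) := by
  refine ⟨lipschitzChains_zero X, fun hX ε hε n c hc => ?_⟩
  obtain ⟨r, hr, γ, hγ, hU⟩ := hX.exists_uniform (isCompact_image c)
  obtain ⟨A, hA, H⟩ := exists_lipschitzApproximation hγ.le hU n
  -- The bound is `ε / 2` because a ball of radius `A * δ` has diameter up to `2 * A * δ`.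
  obtain ⟨δ, hδ, hδr, hδε⟩ : ∃ δ : ℝ, 0 < δ ∧ A * δ < r ∧ A * δ < ε / 2 := by
    have hm : 0 < min r (ε / 2) := lt_min hr (half_pos hε)
    have h : A * (min r (ε / 2) / (A + 1)) < min r (ε / 2) := by
      rw [mul_div_assoc', div_lt_iff₀ (by positivity)]
      nlinarith
    exact ⟨_, div_pos hm (by positivity), h.trans_le (min_le_left _ _), h.trans_le (min_le_right _ _)⟩
  obtain ⟨Φ⟩ := H δ hδ.le hδr
  obtain ⟨m, hm⟩ := exists_subdivision_iterate_mem_supported c hδ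
  set c' := subdivision^[m] c with hc'
  have hc'L : HasLipschitzBoundary c' := hc.subdivision_iterate m
  -- At least one piece is required, so when the subdivided chain vanishes a single zero piece is
  -- used.
  rcases Nat.eq_zero_or_pos c'.support.card with h0 | hpos
  · refine ⟨1, 0, 0, 0, one_pos, fun _ => Submodule.zero_mem _, ⟨m, ?_⟩, ?_, ?_, ?_⟩
    · rw [Finset.card_eq_zero, Finsupp.support_eq_empty] at h0
      simp [← hc', h0]
    · simp
    · simp [image]
    · simpa [image] using hε
  let τ : Fin c'.support.card → C(Simplex n, X) := fun i => c'.support.equivFin.symm i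
  have hsum : ∑ i, c' (τ i) • Finsupp.single (τ i) (1 : ℤ) = c' := by
    rw [c'.support.equivFin.symm.sum_comp
      (fun σ : c'.support => c' σ • Finsupp.single (σ : C(Simplex n, X)) (1 : ℤ)),
      Finset.sum_coe_sort c'.support fun σ => c' σ • Finsupp.single σ (1 : ℤ)]
    conv_rhs => rw [← Finsupp.sum_single c']
    simp [Finsupp.sum]
  have hτ : ∀ i, τ i ∈ smallSimplices (image c) δ n := fun i =>
    (Finsupp.mem_supported ℤ _).1 hm (c'.support.equivFin.symm i).2
  have hmem : ∀ i, Finsupp.single (τ i) (1 : ℤ) ∈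
      Finsupp.supported ℤ ℤ (smallSimplices (image c) δ n) :=
    fun i => single_mem_supported_iff.2 (hτ i)
  let s₀ : Simplex n := stdSimplex.vertex 0
  have himg : ∀ i, image (c' (τ i) • Φ.homotopy (Finsupp.single (τ i) 1)) ⊆
      Metric.closedBall (τ i s₀) (A * δ) := fun i =>
    mem_chainsIn_iff.1 (Submodule.smul_mem _ _ (Φ.homotopy_mem _ (hτ i) s₀))
  refine ⟨c'.support.card,
    fun i => c' (τ i) • (boundary (Φ.homotopy (Finsupp.single (τ i) 1)) +
      Φ.approx (Finsupp.single (τ i) 1)),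
    fun i => c' (τ i) • Φ.approx (Finsupp.single (τ i) 1),
    fun i => c' (τ i) • Φ.homotopy (Finsupp.single (τ i) 1), hpos,
    fun i => Submodule.smul_mem _ _ (Φ.approx_mem _ (hmem i)), ⟨m, ?_⟩, fun i => ?_, fun i => ?_,
    fun i => ?_⟩
  -- By linearity the sum is `bH c' + L c'`, which is `c'` since `c'` has Lipschitz boundary.
  · simp only [smul_add, Finset.sum_add_distrib, ← map_smul, ← map_sum]
    rw [hsum, Φ.boundary_homotopy c' hm hc'L, sub_add_cancel]
  · simp only [map_smul, smul_add, add_sub_cancel_right]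
  · intro x hx
    rw [Metric.mem_thickening_iff]
    exact ⟨τ i s₀, (hτ i).1 ⟨s₀, rfl⟩, (Metric.mem_closedBall.1 (himg i hx)).trans_lt (by linarith)⟩
  · refine (Metric.diam_mono (himg i) Metric.isBounded_closedBall).trans_lt
      ((Metric.diam_closedBall (by positivity)).trans_lt (by linarith))
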